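/- Consider the LTI plant with linear dynamic output-feedback controller $$x_{t+1}=Ax_t+Bu_t+w_t,\quad y_t=Cx_t+v_t,\qquad \mathcal X_t=A_c\mathcal X_{t-1}+B_c y^c_t,\quad u_t=C_c\mathcal X_t,\qquad t\in\mathbb Z,$$ where $(w_t)$ and $(v_t)$ are mutually independent white Gaussian noises with zero mean and covariances $\Sigma_w\succ0$ and $\Sigma_v\succeq0$, and for every $t$ the noises $(w_s,v_s)_{s\ge t}$ are independent of $(x_s,\mathcal X_{s-1})_{s\le t}$. Without attack, $y^c_t=y_t$. A sensor attack $(a_t)_{t\ge0}$ starts at time $0$: the controller then receives $y^{c,a}_t=Cx^a_t+v_t+a_t$, and the attacked run $x^a_t,\mathcal X^a_t$ obeys the same equations with the same noises, $x^a_0=x_0$ and $\mathcal X^a_{-1}=\mathcal X_{-1}$. Put $Y_t=(y_t,\mathcal X_t)$ for all $t$, and let $Y^a_t=(y^{c,a}_t,\mathcal X^a_t)$ for $t\ge0$ and $Y^a_t=Y_t$ for $t<0$. For $\varepsilon>0$, the attack is *$\varepsilon$-stealthy* if for every $t\ge0$ and every measurable detector $D$ that maps a record up to time $t$ to $\{0,1\}$,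 $$\mathbb P\big(D((Y^a_s)_{s\le t})=0\big)+\mathbb P\big(D((Y_s)_{s\le t})=1\big)\ \ge\ 1-\varepsilon .$$ It is *$(\varepsilon,\alpha)$-successful* if it is $\varepsilon$-stealthy and for every $\delta>0$ there is a time $t'\ge0$ with $\mathbb P(\|x^a_{t'}\|_2\ge\alpha)\ge1-\delta$ (hence almost surely $\|x^a_{t'}\|_2\ge\alpha$ at some time $t'$). The system is *$(\varepsilon,\alpha)$-attackable* if an $(\varepsilon,\alpha)$-successful attack exists. Suppose that $A$ is unstable (it has an eigenvalue of modulus greater than $1$) and that the origin of the noiseless closed-loop system with state $(x_t,\mathcal X_t)$ is asymptotically stable. Then the system is $(\varepsilon,\alpha)$-attackable for every $\varepsilon>0$ and every $\alpha\in\mathbb R$. Moreover, for every such $\varepsilon,\alpha$ there is an $(\varepsilon,\alpha)$-successful attack of the deterministic form $$s_{t+1}=As_t,\quad s_0\ne0,\qquad a_t=-Cs_t .$$ -/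

import Mathlib

open MeasureTheory ProbabilityTheory Filter Topology

noncomputable section

/-- An LTI plant `x_{t+1} = A x_t + B u_t + w_t`, `y_t = C x_t + v_t`, where `w_t ~ N(0, covW)` and
`v_t ~ N(0, covV)`, in feedback with the linear dynamic controller
`χ_t = Ac χ_{t-1} + Bc y^c_t`, `u_t = Cc χ_t`.  The dimensions of the plant state, the input, the
output and the controller state are `n`, `m`, `p`, `q`. -/
structure LTIControlSystem (n m p q : ℕ) where
  /-- plant dynamics -/
  A : Matrix (Fin n) (Fin n) ℝ
  /-- plant input matrix -/
  B : Matrix (Fin n) (Fin m) ℝ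
  /-- plant output matrix -/
  C : Matrix (Fin p) (Fin n) ℝ
  /-- controller dynamics -/
  Ac : Matrix (Fin q) (Fin q) ℝ
  /-- controller input matrix -/
  Bc : Matrix (Fin q) (Fin p) ℝ
  /-- controller output matrix -/
  Cc : Matrix (Fin m) (Fin q) ℝ
  /-- covariance of the process noise -/
  covW : Matrix (Fin n) (Fin n) ℝ
  /-- covariance of the measurement noise -/
  covV : Matrix (Fin p) (Fin p) ℝ

/-- A real square matrix is unstable (in discrete time) if it has a complex eigenvalue outside the
closed unit disc. -/
def IsUnstableMatrix {n : ℕ} (A : Matrix (Fin n) (Fin n) ℝ) : Prop :=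
  ∃ z : ℂ, Module.End.HasEigenvalue (Matrix.toLin' (A.map (algebraMap ℝ ℂ))) z ∧ 1 < ‖z‖

/-- Asymptotic stability of the origin for the discrete-time system `X_{t+1} = F X_t`: Lyapunov
stability together with attractivity. -/
def IsAsymptoticallyStable {E : Type*} [NormedAddCommGroup E] (F : E → E) : Prop :=
  (∀ r > 0, ∃ δ > 0, ∀ ξ : E, ‖ξ‖ < δ → ∀ t : ℕ, ‖F^[t] ξ‖ < r) ∧
    ∃ δ > 0, ∀ ξ : E, ‖ξ‖ < δ → Tendsto (fun t : ℕ => F^[t] ξ) atTop (𝓝 0)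

namespace LTIControlSystem

variable {n m p q : ℕ} (S : LTIControlSystem n m p q)

/-- The plant's state update `A x + B u + w`. -/
def plantStep (x : EuclideanSpace ℝ (Fin n)) (u : EuclideanSpace ℝ (Fin m))
    (w : EuclideanSpace ℝ (Fin n)) : EuclideanSpace ℝ (Fin n) :=
  S.A.toEuclideanLin x + S.B.toEuclideanLin u + w

/-- The sensor output `C x + v`. -/
def output (x : EuclideanSpace ℝ (Fin n)) (v : EuclideanSpace ℝ (Fin p)) :
    EuclideanSpace ℝ (Fin p) :=
  S.C.toEuclideanLin x + v

/-- The controller's state update `Ac χ + Bc y`, from the previous controller state `χ` and the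
currently received measurement `y`. -/
def controllerStep (χ : EuclideanSpace ℝ (Fin q)) (y : EuclideanSpace ℝ (Fin p)) :
    EuclideanSpace ℝ (Fin q) :=
  S.Ac.toEuclideanLin χ + S.Bc.toEuclideanLin y

/-- The control input `Cc χ`. -/
def control (χ : EuclideanSpace ℝ (Fin q)) : EuclideanSpace ℝ (Fin m) :=
  S.Cc.toEuclideanLin χ

/-- The noiseless closed loop `(x_t, χ_t) ↦ (x_{t+1}, χ_{t+1})`. -/
def closedLoop (X : EuclideanSpace ℝ (Fin n) × EuclideanSpace ℝ (Fin q)) :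
    EuclideanSpace ℝ (Fin n) × EuclideanSpace ℝ (Fin q) :=
  let x' := S.plantStep X.1 (S.control X.2) 0
  (x', S.controllerStep X.2 (S.output x' 0))

/-- A two-sided (time set `ℤ`) run of the attack-free closed loop on a probability space: white
Gaussian noises `w`, `v`, independent of each other, and a nonanticipative solution `x`, `χ` of the
closed-loop equations driven by them. -/
structure Run {Ω : Type*} [MeasurableSpace Ω] (μ : Measure Ω) where
  /-- process noise -/
  w : ℤ → Ω → EuclideanSpace ℝ (Fin n)
  /-- measurement noise -/
  v : ℤ → Ω → EuclideanSpace ℝ (Fin p)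
  /-- plant state -/
  x : ℤ → Ω → EuclideanSpace ℝ (Fin n)
  /-- controller state -/
  χ : ℤ → Ω → EuclideanSpace ℝ (Fin q)
  measurable_w : ∀ t, Measurable (w t)
  measurable_v : ∀ t, Measurable (v t)
  measurable_x : ∀ t, Measurable (x t)
  measurable_χ : ∀ t, Measurable (χ t)
  hasLaw_w : ∀ t, HasLaw (w t) (multivariateGaussian 0 S.covW) μ
  hasLaw_v : ∀ t, HasLaw (v t) (multivariateGaussian 0 S.covV) μ
  indep_w_v : ∀ t, IndepFun (w t) (v t) μ
  indep_time : iIndepFun (fun (t : ℤ) ω => (w t ω, v t ω)) μ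
  /-- The noises from time `t` on are independent of the plant states up to time `t` and of the
  controller states before time `t`. -/
  nonanticipative : ∀ t : ℤ, IndepFun
    (fun ω (s : Set.Iic t) => (x s ω, χ ((s : ℤ) - 1) ω))
    (fun ω (s : Set.Ici t) => (w s ω, v s ω)) μ
  plant_eq : ∀ t, ∀ᵐ ω ∂μ, x (t + 1) ω = S.plantStep (x t ω) (S.control (χ t ω)) (w t ω)
  controller_eq : ∀ t, ∀ᵐ ω ∂μ,
    χ t ω = S.controllerStep (χ (t - 1) ω) (S.output (x t ω) (v t ω))

namespace Run

variable {S}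
variable {Ω : Type*} [MeasurableSpace Ω] {μ : Measure Ω} (R : S.Run μ)

/-- The closed loop under the sensor attack `a_0, a_1, …`, which starts at time `0`.  The value at
`t` is `(x^a_t, χ^a_{t-1})`; before the attack nothing differs, so that the value at `0` is
`(x_0, χ_{-1})`.  The controller receives `y^a_t + a_t`, where `y^a_t = C x^a_t + v_t`. -/
def attackedPair (a : ℕ → Ω → EuclideanSpace ℝ (Fin p)) :
    ℕ → Ω → EuclideanSpace ℝ (Fin n) × EuclideanSpace ℝ (Fin q)
  | 0, ω => (R.x 0 ω, R.χ (-1) ω)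
  | t + 1, ω =>
    let xa := (attackedPair a t ω).1
    let χa := S.controllerStep (attackedPair a t ω).2 (S.output xa (R.v t ω) + a t ω)
    (S.plantStep xa (S.control χa) (R.w t ω), χa)

/-- The plant state `x^a_t` under attack. -/
def attackedState (a : ℕ → Ω → EuclideanSpace ℝ (Fin p)) (t : ℕ) (ω : Ω) :
    EuclideanSpace ℝ (Fin n) :=
  (R.attackedPair a t ω).1

/-- The controller state `χ^a_t` under attack. -/
def attackedController (a : ℕ → Ω → EuclideanSpace ℝ (Fin p)) (t : ℕ) (ω : Ω) :
    EuclideanSpace ℝ (Fin q) :=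
  (R.attackedPair a (t + 1) ω).2

/-- The measurement `y^{c,a}_t = C x^a_t + v_t + a_t` received by the controller under attack. -/
def attackedMeasurement (a : ℕ → Ω → EuclideanSpace ℝ (Fin p)) (t : ℕ) (ω : Ω) :
    EuclideanSpace ℝ (Fin p) :=
  S.output (R.attackedState a t ω) (R.v t ω) + a t ω

/-- The data `Y_t = (y^c_t, χ_t)` that reach the intrusion detector at time `t`, without attack. -/
def observation (t : ℤ) (ω : Ω) : EuclideanSpace ℝ (Fin p) × EuclideanSpace ℝ (Fin q) :=
  (S.output (R.x t ω) (R.v t ω), R.χ t ω)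

/-- The data that reach the intrusion detector at time `t` under attack: `Y_t` for `t < 0` and
`Y^a_t = (y^{c,a}_t, χ^a_t)` for `0 ≤ t`. -/
def attackedObservation (a : ℕ → Ω → EuclideanSpace ℝ (Fin p)) (t : ℤ) (ω : Ω) :
    EuclideanSpace ℝ (Fin p) × EuclideanSpace ℝ (Fin q) :=
  if t < 0 then R.observation t ω
  else (R.attackedMeasurement a t.toNat ω, R.attackedController a t.toNat ω)

/-- The sum of the error probabilities of a detector `D` that decides at time `t` from the whole
record up to `t` (`true` = attack): the probability of a missed detection plus that of a false
alarm. -/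
def errorSum (a : ℕ → Ω → EuclideanSpace ℝ (Fin p)) (t : ℤ)
    (D : (Set.Iic t → EuclideanSpace ℝ (Fin p) × EuclideanSpace ℝ (Fin q)) → Bool) : ℝ :=
  μ.real {ω | D (fun s => R.attackedObservation a s ω) = false} +
    μ.real {ω | D (fun s => R.observation s ω) = true}

/-- The attack is `ε`-stealthy: at no time `t ≥ 0` is there a detector with total error probability
below `1 - ε`. -/
def IsStealthy (ε : ℝ) (a : ℕ → Ω → EuclideanSpace ℝ (Fin p)) : Prop :=
  ∀ t : ℕ, ¬ ∃ D : (Set.Iic (t : ℤ) → EuclideanSpace ℝ (Fin p) × EuclideanSpace ℝ (Fin q)) → Bool,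
    Measurable D ∧ R.errorSum a t D < 1 - ε

/-- The attack is `(ε, α)`-successful: it is `ε`-stealthy and drives the plant state to norm at
least `α`.  The state is perturbed by unbounded noise, so the latter means: with probability
arbitrarily close to one at a suitable time (in particular, almost surely at some time). -/
def IsSuccessful (ε α : ℝ) (a : ℕ → Ω → EuclideanSpace ℝ (Fin p)) : Prop :=
  (∀ δ > 0, ∃ t' : ℕ, 1 - δ ≤ μ.real {ω | α ≤ ‖R.attackedState a t' ω‖}) ∧ R.IsStealthy ε a

/-- The system is `(ε, α)`-attackable: some attack sequence, possibly depending on the realization,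
is `(ε, α)`-successful. -/
def IsAttackable (ε α : ℝ) : Prop :=
  ∃ a : ℕ → Ω → EuclideanSpace ℝ (Fin p), (∀ t, Measurable (a t)) ∧ R.IsSuccessful ε α a

end Run

end LTIControlSystem

end

open MeasureTheory ProbabilityTheory Filter Topology

noncomputable section

/-! ### Total variation continuity of translations -/

/-! By linearity, the attack `-C s_t` makes the controller behave exactly as if the plant had
started from `x_0 - s_0`, while the true state is that fictitious closed-loop state plus `s_t`
(`attackedPair_eq`). Two facts then finish the proof.

Stealth: `x_0` contains `w_{-1}` additively, so replacing `x_0` by `x_0 - s_0` amounts to replacing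
`w_{-1}` by `w_{-1} - s_0`. Nothing recorded before time `0` involves `w_{-1}`, and `w_{-1}` is
independent of everything else that enters the record. Hence no detector does better than one
distinguishing the law of `w_{-1}` from its translate. This law has a density because the covariance
is positive definite, and translation is continuous in `L¹`, so the advantage is at most `ε` once
`s_0` is small (`exists_measure_preimage_sub_le`, `measure_sub_mem_le`, `isStealthy_of_forall_eq`).

Damage: the fictitious closed loop is stable, so its states are tight uniformly in time
(`exists_measureReal_trajectory_gt_le`), whereas `s_t` can be taken on an unbounded orbit of `A`,
however small `s_0` is. -/

theorem Measure.pi_absolutelyContinuous {n : ℕ} (μ ν : Measure ℝ) [SigmaFinite μ] [SigmaFinite ν]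
    (h : μ ≪ ν) :
    Measure.pi (fun _ : Fin n => μ) ≪ Measure.pi (fun _ : Fin n => ν) := by
  induction n with
  | zero => rw [Measure.pi_of_empty, Measure.pi_of_empty]
  | succ k ih =>
    have hμ := (measurePreserving_piFinSuccAbove (fun _ : Fin (k + 1) => μ) 0).symm
    have hν := (measurePreserving_piFinSuccAbove (fun _ : Fin (k + 1) => ν) 0).symm
    rw [← hμ.map_eq, ← hν.map_eq]
    exact (h.prod ih).map hμ.measurable

/-- The law is the image of the standard Gaussian under the square root of `W`, which is invertible
for positive definite `W` and so preserves Lebesgue null sets. -/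
theorem multivariateGaussian_absolutelyContinuous {n : ℕ} {W : Matrix (Fin n) (Fin n) ℝ}
    (hW : W.PosDef) : multivariateGaussian 0 W ≪ volume := by
  have hstd : stdGaussian (EuclideanSpace ℝ (Fin n)) ≪ volume := by
    rw [← map_pi_eq_stdGaussian, ← (PiLp.volume_preserving_toLp (Fin n)).map_eq]
    exact (Measure.pi_absolutelyContinuous _ _
      (gaussianReal_absolutelyContinuous 0 one_ne_zero)).map
        (PiLp.volume_preserving_toLp (Fin n)).measurable
  open scoped MatrixOrder in
  have hdet : IsUnit (CFC.sqrt W) := by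
    rw [CFC.isUnit_sqrt_iff W hW.posSemidef.nonneg]
    exact hW.isUnit
  let T := Matrix.toEuclideanCLM (𝕜 := ℝ) (CFC.sqrt W)
  have hT : IsUnit T := hdet.map Matrix.toEuclideanCLM
  obtain ⟨u, hu⟩ := hT
  let e := ContinuousLinearEquiv.unitsEquiv ℝ (EuclideanSpace ℝ (Fin n)) u
  have he : ∀ x, e x = T x := fun x => by rw [← hu]; rfl
  rw [multivariateGaussian]
  have hfun : (fun x => (0 : EuclideanSpace ℝ (Fin n)) +
      Matrix.toEuclideanCLM (𝕜 := ℝ) (CFC.sqrt W) x) = e := by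
    funext x; rw [zero_add, he]
  rw [hfun]
  refine (hstd.map e.continuous.measurable).trans ?_
  refine Measure.AbsolutelyContinuous.mk fun s hs h0 => ?_
  rw [Measure.map_apply e.continuous.measurable hs]
  exact (Measure.addHaar_preimage_continuousLinearEquiv volume e s).trans (by rw [h0, mul_zero])

theorem exists_measure_preimage_sub_le {E : Type*} [NormedAddCommGroup E] [InnerProductSpace ℝ E]
    [FiniteDimensional ℝ E] [MeasurableSpace E] [BorelSpace E] (γ : Measure E)
    [IsFiniteMeasure γ] (hγ : γ ≪ volume) {ε : ℝ} (hε : 0 < ε) :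
    ∃ r > 0, ∀ s : E, ‖s‖ < r → ∀ B : Set E, MeasurableSet B →
      γ ((fun w => w - s) ⁻¹' B) ≤ γ B + ENNReal.ofReal ε := by
  let f : E → ℝ := fun w => (γ.rnDeriv volume w).toReal
  have hf : Integrable f := Measure.integrable_toReal_rnDeriv
  have hreal : ∀ B, MeasurableSet B → γ.real B = ∫ w in B, f w := fun B _ =>
    (Measure.setIntegral_toReal_rnDeriv hγ B).symm
  let g : E → C(E, E) := fun s => ⟨fun w => s + w, by fun_prop⟩
  have hgm : ∀ s, MeasurePreserving (g s) volume volume := fun s => measurePreserving_add_left _ s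
  have hg : Continuous g := by
    have : Continuous (fun z : E × E => z.1 + z.2) := by fun_prop
    exact (ContinuousMap.curry ⟨_, this⟩).continuous
  let F : Lp ℝ 1 (volume : Measure E) := (memLp_one_iff_integrable.2 hf).toLp f
  -- Continuity of translation in `L¹`, applied to the density of `γ`; the resulting `r` serves all
  -- `B` at once.
  have hcont : Continuous fun s => Lp.compMeasurePreserving (g s) (hgm s) F :=
    continuous_const.compMeasurePreservingLp hg hgm (by simp)
  have hzero : Lp.compMeasurePreserving (g 0) (hgm 0) F = F := by
    apply Lp.ext
    refine (Lp.coeFn_compMeasurePreserving F (hgm 0)).trans ?_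
    have : (g 0 : E → E) = id := by funext w; simp [g]
    rw [this]; rfl
  obtain ⟨r, hr, h⟩ := Metric.continuousAt_iff.1 (hcont.continuousAt (x := 0)) ε hε
  refine ⟨r, hr, fun s hs B hB => ?_⟩
  have hd := h (x := s) (by simpa using hs)
  rw [hzero, dist_eq_norm, L1.norm_eq_integral_norm] at hd
  have hae : ∀ᵐ w, ‖(Lp.compMeasurePreserving (g s) (hgm s) F - F : Lp ℝ 1 volume) w‖
      = ‖f (s + w) - f w‖ := by
    have h1 := Lp.coeFn_compMeasurePreserving F (hgm s)
    have h2 : F =ᵐ[volume] f := MemLp.coeFn_toLp _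
    filter_upwards [Lp.coeFn_sub (Lp.compMeasurePreserving (g s) (hgm s) F) F, h1, h2,
      (hgm s).quasiMeasurePreserving.ae h2] with w a b c d
    rw [a, Pi.sub_apply, b, c, Function.comp_apply, d]
    rfl
  rw [integral_congr_ae hae] at hd
  have hfs : Integrable fun w => f (s + w) := hf.comp_add_left s
  have hpre : γ.real ((fun w => w - s) ⁻¹' B) = ∫ w in B, f (s + w) := by
    have hm : Measurable fun w : E => w - s := measurable_id.sub_const s
    rw [hreal _ (hm hB)]
    have := (hgm s).setIntegral_preimage_emb (Homeomorph.addLeft s).measurableEmbedding f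
      ((fun w => w - s) ⁻¹' B)
    rw [← this]
    congr 2
    ext w
    simp [g]
  have key : γ.real ((fun w => w - s) ⁻¹' B) ≤ γ.real B + ε := by
    rw [hpre, hreal B hB]
    have h1 : ∫ w in B, (f (s + w) - f w) ≤ ∫ w, ‖f (s + w) - f w‖ := by
      calc ∫ w in B, (f (s + w) - f w) ≤ ∫ w in B, ‖f (s + w) - f w‖ :=
            integral_mono (hfs.sub hf).integrableOn (hfs.sub hf).norm.integrableOn
              fun w => Real.le_norm_self _
        _ ≤ _ := setIntegral_le_integral (hfs.sub hf).norm
              (Eventually.of_forall fun w => norm_nonneg _)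
    rw [integral_sub hfs.integrableOn hf.integrableOn] at h1
    linarith
  rw [measureReal_def, measureReal_def] at key
  rw [← ENNReal.ofReal_toReal (measure_ne_top γ ((fun w => w - s) ⁻¹' B)),
    ← ENNReal.ofReal_toReal (measure_ne_top γ B), ← ENNReal.ofReal_add (by positivity) hε.le]
  exact ENNReal.ofReal_le_ofReal key

/-- By Fubini, the bound on each section of `G` at fixed `V` integrates to a bound on `G`. The
σ-algebra on `F` is an explicit argument so that `V` can later be the identity of `Ω` with a smaller
σ-algebra. -/
theorem measure_sub_mem_le {E F Ω : Type*} [AddGroup E] [MeasurableSpace E] [MeasurableSub E]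
    {mF : MeasurableSpace F} {mΩ : MeasurableSpace Ω} {μ : Measure Ω} [IsProbabilityMeasure μ]
    {U : Ω → E} {V : Ω → F} (hU : Measurable U) (hV : Measurable V) (h : IndepFun U V μ)
    {s : E} {c : ENNReal}
    (hs : ∀ B : Set E, MeasurableSet B →
      μ.map U ((fun w => w - s) ⁻¹' B) ≤ μ.map U B + c)
    {G : Set (E × F)} (hG : MeasurableSet G) :
    μ {ω | (U ω - s, V ω) ∈ G} ≤ μ {ω | (U ω, V ω) ∈ G} + c := by
  have hprod := (indepFun_iff_map_prod_eq_prod_map_map hU.aemeasurable hV.aemeasurable).1 h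
  have := Measure.isProbabilityMeasure_map (μ := μ) hU.aemeasurable
  have := Measure.isProbabilityMeasure_map (μ := μ) hV.aemeasurable
  have hsub : Measurable fun z : E × F => (z.1 - s, z.2) :=
    (measurable_fst.sub_const s).prodMk measurable_snd
  have e1 : μ {ω | (U ω - s, V ω) ∈ G} =
      ((μ.map U).prod (μ.map V)) ((fun z : E × F => (z.1 - s, z.2)) ⁻¹' G) := by
    rw [← hprod, Measure.map_apply (hU.prodMk hV) (hsub hG)]; rfl
  have e2 : μ {ω | (U ω, V ω) ∈ G} = ((μ.map U).prod (μ.map V)) G := by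
    rw [← hprod, Measure.map_apply (hU.prodMk hV) hG]; rfl
  rw [e1, e2, Measure.prod_apply_symm (hsub hG), Measure.prod_apply_symm hG]
  calc _ ≤ ∫⁻ y, (μ.map U ((fun x => (x, y)) ⁻¹' G) + c) ∂(μ.map V) :=
        lintegral_mono fun y => hs _ (measurable_prodMk_right hG)
    _ = _ := by
        rw [lintegral_add_right _ measurable_const, lintegral_const, measure_univ, mul_one]

/-! ### Independence -/

/-- On the π-system of sets `a ∩ b`, `P(a ∩ u ∩ b) = P(a) P(u ∩ b) = P(a) P(u) P(b)`, and `P(a) P(b)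
= P(a ∩ b)`. -/
theorem indep_sup_of_indep_sup {Ω : Type*} {mΩ : MeasurableSpace Ω} {μ : Measure Ω}
    [IsProbabilityMeasure μ] {mU mV mZ : MeasurableSpace Ω} (hU : mU ≤ mΩ) (hV : mV ≤ mΩ)
    (hZ : mZ ≤ mΩ) (h : Indep mZ (mU ⊔ mV) μ) (hUV : Indep mU mV μ) :
    Indep mU (mZ ⊔ mV) μ := by
  let p : Set (Set Ω) := {s | ∃ a b, MeasurableSet[mZ] a ∧ MeasurableSet[mV] b ∧ s = a ∩ b}
  have hp : IsPiSystem p := by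
    rintro _ ⟨a, b, ha, hb, rfl⟩ _ ⟨a', b', ha', hb', rfl⟩ -
    exact ⟨a ∩ a', b ∩ b', ha.inter ha', hb.inter hb', by
      rw [Set.inter_inter_inter_comm]⟩
  have hgen : mZ ⊔ mV = MeasurableSpace.generateFrom p := by
    apply le_antisymm
    · refine sup_le (fun a ha => ?_) (fun b hb => ?_)
      · exact MeasurableSpace.measurableSet_generateFrom
          ⟨a, Set.univ, ha, MeasurableSet.univ, by simp⟩
      · exact MeasurableSpace.measurableSet_generateFrom
          ⟨Set.univ, b, MeasurableSet.univ, hb, by simp⟩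
    · refine MeasurableSpace.generateFrom_le ?_
      rintro _ ⟨a, b, ha, hb, rfl⟩
      exact ((le_sup_left : mZ ≤ mZ ⊔ mV) a ha).inter ((le_sup_right : mV ≤ mZ ⊔ mV) b hb)
  refine IndepSets.indep hU (sup_le hZ hV) (@MeasurableSpace.isPiSystem_measurableSet _ mU) hp
    (@MeasurableSpace.generateFrom_measurableSet _ mU).symm hgen ?_
  rw [IndepSets_iff]
  rintro u _ hu ⟨a, b, ha, hb, rfl⟩
  rw [Indep_iff] at h hUV
  have h1 := h a (u ∩ b) ha
    (((le_sup_left : mU ≤ mU ⊔ mV) u hu).inter ((le_sup_right : mV ≤ mU ⊔ mV) b hb))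
  have h2 := h a b ha ((le_sup_right : mV ≤ mU ⊔ mV) b hb)
  rw [Set.inter_left_comm, h1, h2, hUV u b hu hb, mul_left_comm]

/-! ### Linear dynamics -/

/-- Convergence on a basis makes some power `G ^ N` have norm at most `1/2`. Splitting the sum at
`N` bounds it by its first `N` terms plus half of itself. -/
theorem exists_sum_norm_pow_le {E : Type*} [NormedAddCommGroup E] [NormedSpace ℝ E]
    [FiniteDimensional ℝ E] (G : E →L[ℝ] E)
    (h : ∀ x, Tendsto (fun t : ℕ => (G ^ t) x) atTop (𝓝 0)) :
    ∃ M : ℝ, ∀ T : ℕ, ∑ j ∈ Finset.range T, ‖G ^ j‖ ≤ M := by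
  obtain ⟨C, hC, hop⟩ := (Module.finBasis ℝ E).exists_opNorm_le (F := E)
  have hev : ∀ᶠ t : ℕ in atTop, ∀ i, ‖(G ^ t) (Module.finBasis ℝ E i)‖ < 1 / (2 * C) := by
    refine eventually_all.2 fun i => ?_
    have := (h (Module.finBasis ℝ E i)).norm
    rw [norm_zero] at this
    exact this.eventually (gt_mem_nhds (by positivity))
  obtain ⟨N, hN⟩ := hev.exists
  have hGN : ‖G ^ N‖ ≤ 1 / 2 := by
    have := hop (u := G ^ N) (M := 1 / (2 * C)) (by positivity) fun i => (hN i).le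
    calc _ ≤ _ := this
      _ = 1 / 2 := by field_simp
  refine ⟨2 * ∑ j ∈ Finset.range N, ‖G ^ j‖, fun T => ?_⟩
  have h1 : ∑ j ∈ Finset.range T, ‖G ^ j‖ ≤ ∑ j ∈ Finset.range (N + T), ‖G ^ j‖ :=
    Finset.sum_le_sum_of_subset_of_nonneg (Finset.range_mono (by omega)) fun _ _ _ => norm_nonneg _
  rw [Finset.sum_range_add] at h1
  have h2 : ∑ j ∈ Finset.range T, ‖G ^ (N + j)‖ ≤ ∑ j ∈ Finset.range T, 1 / 2 * ‖G ^ j‖ := by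
    refine Finset.sum_le_sum fun j _ => ?_
    rw [pow_add]
    exact (norm_mul_le _ _).trans (by gcongr)
  rw [← Finset.mul_sum] at h2
  linarith

/-- For a complex eigenvector `a + ib`, the real orbits of `a` and `b` are the real and imaginary
parts of `z ^ t (a + ib)`, so they cannot both be bounded. -/
theorem exists_unbounded_orbit_of_isUnstableMatrix {n : ℕ} {A : Matrix (Fin n) (Fin n) ℝ}
    (hA : IsUnstableMatrix A) :
    ∃ x : EuclideanSpace ℝ (Fin n), ∀ K : ℝ, ∃ t : ℕ, K < ‖((Matrix.toEuclideanLin A) ^ t) x‖ := by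
  obtain ⟨z, hz, hz1⟩ := hA
  obtain ⟨y, hy⟩ := hz.exists_hasEigenvector
  have hy0 := hy.2
  obtain ⟨i, hi⟩ : ∃ i, y i ≠ 0 := by
    by_contra! hcon
    exact hy0 (funext hcon)
  let a : EuclideanSpace ℝ (Fin n) := WithLp.toLp 2 fun i => (y i).re
  let b : EuclideanSpace ℝ (Fin n) := WithLp.toLp 2 fun i => (y i).im
  have hstep : ∀ k, (∑ j, (A k j : ℂ) * y j) = z * y k := fun k => by
    have := congrFun (Module.End.mem_eigenspace_iff.1 hy.1) k
    simpa [Matrix.toLin'_apply, Matrix.mulVec, dotProduct] using this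
  have horb : ∀ t : ℕ, ∀ k, ((((Matrix.toEuclideanLin A) ^ t) a k : ℝ) : ℂ) +
      ((((Matrix.toEuclideanLin A) ^ t) b k : ℝ) : ℂ) * Complex.I = z ^ t * y k := by
    intro t
    induction t with
    | zero => intro k; simp [a, b, Complex.re_add_im]
    | succ t ih =>
      intro k
      have happ : ∀ v : EuclideanSpace ℝ (Fin n), ((Matrix.toEuclideanLin A) ^ (t + 1)) v k =
          ∑ j, A k j * ((Matrix.toEuclideanLin A) ^ t) v j := fun v => by
        rw [pow_succ', Module.End.mul_apply]
        simp [Matrix.toLpLin_apply, Matrix.mulVec, dotProduct]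
      rw [happ, happ]
      push_cast
      rw [Finset.sum_mul, ← Finset.sum_add_distrib, pow_succ, mul_assoc, ← hstep k,
        Finset.mul_sum]
      refine Finset.sum_congr rfl fun j _ => ?_
      linear_combination (A k j : ℂ) * ih j
  by_contra! hcon
  obtain ⟨Ka, hKa⟩ := hcon a
  obtain ⟨Kb, hKb⟩ := hcon b
  have hlim := (tendsto_pow_atTop_atTop_of_one_lt hz1).atTop_mul_const (norm_pos_iff.2 hi)
  obtain ⟨t, ht⟩ := (hlim.eventually_gt_atTop (Ka + Kb)).exists
  have h1 := congrArg norm (horb t i)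
  rw [norm_mul, norm_pow] at h1
  have h2 : ‖((((Matrix.toEuclideanLin A) ^ t) a i : ℝ) : ℂ) +
      ((((Matrix.toEuclideanLin A) ^ t) b i : ℝ) : ℂ) * Complex.I‖ ≤ Ka + Kb := by
    refine (norm_add_le _ _).trans (add_le_add ?_ ?_)
    · rw [Complex.norm_real]
      exact (PiLp.norm_apply_le _ i).trans (hKa t)
    · rw [norm_mul, Complex.norm_I, mul_one, Complex.norm_real]
      exact (PiLp.norm_apply_le _ i).trans (hKb t)
  linarith

/-! ### The closed loop as an affine recursion -/

namespace LTIControlSystem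

variable {n m p q : ℕ} (S : LTIControlSystem n m p q)

/-- One step `(x_t, χ_{t-1}) ↦ (x_{t+1}, χ_t)` of the closed loop with noises `w`, `v`. -/
def loopStep (w : EuclideanSpace ℝ (Fin n)) (v : EuclideanSpace ℝ (Fin p))
    (X : EuclideanSpace ℝ (Fin n) × EuclideanSpace ℝ (Fin q)) :
    EuclideanSpace ℝ (Fin n) × EuclideanSpace ℝ (Fin q) :=
  let χ := S.controllerStep X.2 (S.output X.1 v)
  (S.plantStep X.1 (S.control χ) w, χ)

/-- The closed-loop trajectory `t ↦ (x_t, χ_{t-1})` from a given initial pair. -/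
def trajectory (w : ℕ → EuclideanSpace ℝ (Fin n)) (v : ℕ → EuclideanSpace ℝ (Fin p))
    (X : EuclideanSpace ℝ (Fin n) × EuclideanSpace ℝ (Fin q)) :
    ℕ → EuclideanSpace ℝ (Fin n) × EuclideanSpace ℝ (Fin q)
  | 0 => X
  | t + 1 => S.loopStep (w t) (v t) (trajectory w v X t)

/-- The noiseless step `(x_t, χ_{t-1}) ↦ (x_{t+1}, χ_t)` as a continuous linear map. -/
def loopCLM : (EuclideanSpace ℝ (Fin n) × EuclideanSpace ℝ (Fin q)) →L[ℝ]
    (EuclideanSpace ℝ (Fin n) × EuclideanSpace ℝ (Fin q)) :=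
  LinearMap.toContinuousLinearMap
    { toFun := S.loopStep 0 0
      map_add' := fun X Y => by
        ext1 <;> simp only [loopStep, plantStep, control, controllerStep, output, Prod.fst_add,
          Prod.snd_add, map_add, add_zero] <;> abel
      map_smul' := fun c X => by
        ext1 <;> simp [loopStep, plantStep, control, controllerStep, output] }

theorem loopCLM_apply (X : EuclideanSpace ℝ (Fin n) × EuclideanSpace ℝ (Fin q)) :
    S.loopCLM X = S.loopStep 0 0 X := rfl

theorem loopStep_eq (w : EuclideanSpace ℝ (Fin n)) (v : EuclideanSpace ℝ (Fin p))
    (X : EuclideanSpace ℝ (Fin n) × EuclideanSpace ℝ (Fin q)) :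
    S.loopStep w v X = S.loopCLM X + S.loopStep w v 0 := by
  rw [loopCLM_apply]
  ext1 <;> simp only [loopStep, plantStep, control, controllerStep, output, Prod.fst_zero,
    Prod.snd_zero, map_add, add_zero, map_zero, Prod.mk_add_mk, zero_add] <;> abel

theorem trajectory_eq (w : ℕ → EuclideanSpace ℝ (Fin n)) (v : ℕ → EuclideanSpace ℝ (Fin p))
    (X : EuclideanSpace ℝ (Fin n) × EuclideanSpace ℝ (Fin q)) (t : ℕ) :
    S.trajectory w v X t = (S.loopCLM ^ t) X +
      -- The truncated subtraction is harmless, since `j < t`.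
      ∑ j ∈ Finset.range t, (S.loopCLM ^ j) (S.loopStep (w (t - 1 - j)) (v (t - 1 - j)) 0) := by
  induction t with
  | zero => simp [trajectory]
  | succ t ih =>
    rw [trajectory, loopStep_eq, ih, map_add, map_sum, Finset.sum_range_succ', add_assoc]
    congr 1
    · rw [pow_succ']; rfl
    · congr 1
      refine Finset.sum_congr rfl fun j _ => ?_
      rw [pow_succ', show t + 1 - 1 - (j + 1) = t - 1 - j by omega]; rfl

/-- The stability hypothesis concerns the pairs `(x_t, χ_t)`, the recursion the pairs `(x_t,
χ_{t-1})`. With `P` the plant half-step and `Q` the controller half-step, the two maps are `Q ∘ P`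
and `P ∘ Q`, so `P` carries orbits of the first to orbits of the second. -/
theorem tendsto_loopCLM_pow (hcl : IsAsymptoticallyStable S.closedLoop)
    (X : EuclideanSpace ℝ (Fin n) × EuclideanSpace ℝ (Fin q)) :
    Tendsto (fun t : ℕ => (S.loopCLM ^ t) X) atTop (𝓝 0) := by
  obtain ⟨-, δ, hδ, hattr⟩ := hcl
  let P : EuclideanSpace ℝ (Fin n) × EuclideanSpace ℝ (Fin q) →
      EuclideanSpace ℝ (Fin n) × EuclideanSpace ℝ (Fin q) :=
    fun X => (S.plantStep X.1 (S.control X.2) 0, X.2)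
  let Q : EuclideanSpace ℝ (Fin n) × EuclideanSpace ℝ (Fin q) →
      EuclideanSpace ℝ (Fin n) × EuclideanSpace ℝ (Fin q) :=
    fun X => (X.1, S.controllerStep X.2 (S.output X.1 0))
  have hlin : ∀ (k l : ℕ) (M : Matrix (Fin k) (Fin l) ℝ), Continuous M.toEuclideanLin :=
    fun k l M => LinearMap.continuous_of_finiteDimensional _
  have hP : Continuous P := by
    have hA := hlin _ _ S.A
    have hB := hlin _ _ S.B
    have hC := hlin _ _ S.Cc
    simp only [P, plantStep, control]
    fun_prop
  have hQ : Continuous Q := by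
    have hA := hlin _ _ S.Ac
    have hB := hlin _ _ S.Bc
    have hC := hlin _ _ S.C
    simp only [Q, controllerStep, output]
    fun_prop
  have hP0 : P 0 = 0 := by simp [P, plantStep, control]
  have hQ0 : Q 0 = 0 := by simp [Q, controllerStep, output]
  have hsemi : Function.Semiconj P S.closedLoop S.loopCLM := fun X => rfl
  have hPQ : ∀ X, S.loopCLM X = P (Q X) := fun X => rfl
  have hball : ∀ᶠ X in 𝓝 (0 : EuclideanSpace ℝ (Fin n) × EuclideanSpace ℝ (Fin q)),
      ‖Q X‖ < δ := by
    have := hQ.norm.tendsto 0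
    rw [hQ0, norm_zero] at this
    exact this.eventually_lt_const hδ
  have hsmall : ∀ X, ‖Q X‖ < δ → Tendsto (fun t : ℕ => (S.loopCLM ^ t) X) atTop (𝓝 0) := by
    intro X hX
    rw [← tendsto_add_atTop_iff_nat 1]
    have h1 := (hP.tendsto 0).comp (hattr (Q X) hX)
    rw [hP0] at h1
    refine h1.congr fun t => ?_
    rw [Function.comp_apply, (hsemi.iterate_right t).eq, pow_succ, mul_apply_eq_comp,
      hPQ]
    exact (congrFun (hom_coe_pow (fun f : _ →L[ℝ] _ => ⇑f) rfl (fun _ _ => rfl) S.loopCLM t) _).symm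
  -- Linearity removes the smallness condition: shrink `X`, then rescale the limit.
  have hscale : Tendsto (fun c : ℝ => c • X) (𝓝[≠] 0) (𝓝 0) := by
    have : Continuous fun c : ℝ => c • X := by fun_prop
    simpa using (this.tendsto 0).mono_left nhdsWithin_le_nhds
  obtain ⟨c, hc, hc0⟩ := ((hscale.eventually hball).and self_mem_nhdsWithin).exists
  have h2 := (hsmall _ hc).const_smul c⁻¹
  simpa [smul_smul, inv_mul_cancel₀ hc0] using h2

end LTIControlSystem

/-! ### Tightness of the closed loop -/

theorem exists_measureReal_norm_gt_le {Ω E : Type*} [MeasurableSpace Ω] [NormedAddCommGroup E]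
    [MeasurableSpace E] [OpensMeasurableSpace E] {μ : Measure Ω} [IsProbabilityMeasure μ]
    {X : Ω → E} (hX : Measurable X) {δ : ℝ} (hδ : 0 < δ) :
    ∃ L : ℝ, 0 ≤ L ∧ μ.real {ω | L < ‖X ω‖} ≤ δ := by
  have hlim : Tendsto (fun k : ℕ => μ {ω | (k : ℝ) < ‖X ω‖}) atTop
      (𝓝 (μ (⋂ k : ℕ, {ω | (k : ℝ) < ‖X ω‖}))) := by
    refine tendsto_measure_iInter_atTop
      (fun k => (measurableSet_lt measurable_const hX.norm).nullMeasurableSet) ?_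
      ⟨0, measure_ne_top _ _⟩
    intro k l hkl ω hω
    exact lt_of_le_of_lt (Nat.cast_le.2 hkl) (show (l : ℝ) < ‖X ω‖ from hω)
  have hempty : (⋂ k : ℕ, {ω | (k : ℝ) < ‖X ω‖}) = ∅ := by
    ext ω
    simp only [Set.mem_iInter, Set.mem_ofPred_eq, Set.mem_empty_iff_false, iff_false, not_forall,
      not_lt]
    exact exists_nat_ge _
  rw [hempty, measure_empty] at hlim
  obtain ⟨k, hk⟩ := (hlim.eventually_lt_const (ENNReal.ofReal_pos.2 hδ)).exists
  exact ⟨k, by positivity, ENNReal.toReal_le_of_le_ofReal hδ.le hk.le⟩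

namespace LTIControlSystem

variable {n m p q : ℕ} (S : LTIControlSystem n m p q)

theorem exists_norm_loopStep_zero_le : ∃ c : ℝ, 0 ≤ c ∧ ∀ w v,
    ‖S.loopStep w v 0‖ ≤ ‖w‖ + c * ‖v‖ := by
  let T : EuclideanSpace ℝ (Fin p) →L[ℝ] EuclideanSpace ℝ (Fin n) × EuclideanSpace ℝ (Fin q) :=
    LinearMap.toContinuousLinearMap
      (((S.B.toEuclideanLin ∘ₗ S.Cc.toEuclideanLin) ∘ₗ S.Bc.toEuclideanLin).prod
        S.Bc.toEuclideanLin)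
  refine ⟨‖T‖, norm_nonneg _, fun w v => ?_⟩
  have h : S.loopStep w v 0 = (w, 0) + T v := by
    ext1 <;> simp [loopStep, plantStep, control, controllerStep, output, T, add_comm]
  rw [h]
  refine (norm_add_le _ _).trans (add_le_add ?_ (T.le_opNorm v))
  simp [Prod.norm_def]

namespace Run

variable {S}
variable {Ω : Type*} [MeasurableSpace Ω] {μ : Measure Ω} (R : S.Run μ)

/-- Summability of `‖G ^ j‖` bounds the expected noise contribution by `M * K` at every time, and
Markov's inequality applies. The initial value needs only its own tightness, not independence of the
noise. -/
theorem exists_measureReal_trajectory_gt_le [IsProbabilityMeasure μ]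
    (hcl : IsAsymptoticallyStable S.closedLoop)
    {X : Ω → EuclideanSpace ℝ (Fin n) × EuclideanSpace ℝ (Fin q)} (hX : Measurable X)
    {δ : ℝ} (hδ : 0 < δ) :
    ∃ L : ℝ, ∀ t : ℕ, μ.real {ω | L <
      ‖S.trajectory (fun k => R.w k ω) (fun k => R.v k ω) (X ω) t‖} ≤ δ := by
  obtain ⟨M, hM⟩ := exists_sum_norm_pow_le S.loopCLM (S.tendsto_loopCLM_pow hcl)
  have hM0 : 0 ≤ M := by simpa using hM 0
  obtain ⟨c, hc, hstep⟩ := S.exists_norm_loopStep_zero_le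
  let K := ∫ x, ‖x‖ ∂(multivariateGaussian 0 S.covW) +
    c * ∫ x, ‖x‖ ∂(multivariateGaussian 0 S.covV)
  have hK0 : 0 ≤ K := add_nonneg (integral_nonneg fun _ => norm_nonneg _)
    (mul_nonneg hc (integral_nonneg fun _ => norm_nonneg _))
  have hwi : ∀ k, Integrable (fun ω => ‖R.w k ω‖) μ := fun k => by
    have : Integrable (fun x => ‖x‖) (μ.map (R.w k)) := by
      rw [(R.hasLaw_w k).map_eq]; exact IsGaussian.integrable_id.norm
    exact this.comp_measurable (R.measurable_w k)
  have hvi : ∀ k, Integrable (fun ω => ‖R.v k ω‖) μ := fun k => by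
    have : Integrable (fun x => ‖x‖) (μ.map (R.v k)) := by
      rw [(R.hasLaw_v k).map_eq]; exact IsGaussian.integrable_id.norm
    exact this.comp_measurable (R.measurable_v k)
  have hwvi : ∀ k, Integrable (fun ω => ‖R.w k ω‖ + c * ‖R.v k ω‖) μ := fun k =>
    (hwi k).add ((hvi k).const_mul c)
  have hwK : ∀ k, ∫ ω, (‖R.w k ω‖ + c * ‖R.v k ω‖) ∂μ = K := fun k => by
    rw [integral_add (hwi k) ((hvi k).const_mul c), integral_const_mul]
    simp only [K]
    rw [← (R.hasLaw_w k).map_eq, ← (R.hasLaw_v k).map_eq,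
      integral_map (R.measurable_w k).aemeasurable (by fun_prop),
      integral_map (R.measurable_v k).aemeasurable (by fun_prop)]
  obtain ⟨L₁, hL₁, hX₁⟩ := exists_measureReal_norm_gt_le (μ := μ) hX (half_pos hδ)
  -- The summand `1` keeps `L₂` positive when `M * K = 0`.
  let L₂ := 2 * (M * K) / δ + 1
  have hL₂ : 0 < L₂ := by positivity
  refine ⟨M * L₁ + L₂, fun t => ?_⟩
  let H : Ω → ℝ := fun ω => ∑ j ∈ Finset.range t, ‖S.loopCLM ^ j‖ *
    (‖R.w ((t - 1 - j : ℕ) : ℤ) ω‖ + c * ‖R.v ((t - 1 - j : ℕ) : ℤ) ω‖)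
  have hHi : Integrable H μ := integrable_finsetSum _ fun j _ =>
    (hwvi _).const_mul _
  have hH0 : ∀ ω, 0 ≤ H ω := fun ω => Finset.sum_nonneg fun j _ => by positivity
  have hHint : ∫ ω, H ω ∂μ ≤ M * K := by
    simp only [H]
    rw [integral_finsetSum _ fun j _ => (hwvi _).const_mul _]
    simp only [integral_const_mul, hwK]
    rw [← Finset.sum_mul]
    exact mul_le_mul_of_nonneg_right (hM t) hK0
  have hmarkov : μ.real {ω | L₂ ≤ H ω} ≤ δ / 2 := by
    have h1 := mul_meas_ge_le_integral_of_nonneg (Eventually.of_forall hH0) hHi L₂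
    have h2 : M * K ≤ L₂ * (δ / 2) := by
      have : L₂ * (δ / 2) = M * K + δ / 2 := by simp only [L₂]; field_simp
      linarith
    exact le_of_mul_le_mul_left (h1.trans (hHint.trans h2)) hL₂
  have hpow : ‖S.loopCLM ^ t‖ ≤ M :=
    (Finset.single_le_sum (f := fun j => ‖S.loopCLM ^ j‖) (fun _ _ => norm_nonneg _)
      (Finset.self_mem_range_succ t)).trans (hM (t + 1))
  have hsub : {ω | M * L₁ + L₂ <
      ‖S.trajectory (fun k => R.w k ω) (fun k => R.v k ω) (X ω) t‖} ⊆
      {ω | L₁ < ‖X ω‖} ∪ {ω | L₂ ≤ H ω} := by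
    intro ω hω
    by_contra hcon
    simp only [Set.mem_union, Set.mem_ofPred_eq, not_or, not_lt, not_le] at hcon hω
    rw [trajectory_eq] at hω
    have h1 : ‖(S.loopCLM ^ t) (X ω)‖ ≤ M * L₁ :=
      ((S.loopCLM ^ t).le_opNorm _).trans
        (mul_le_mul hpow hcon.1 (norm_nonneg _) hM0)
    have h2 := norm_sum_le_of_le (Finset.range t)
      (f := fun j => (S.loopCLM ^ j) (S.loopStep (R.w ((t - 1 - j : ℕ) : ℤ) ω)
        (R.v ((t - 1 - j : ℕ) : ℤ) ω) 0)) fun j _ =>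
      ((S.loopCLM ^ j).le_opNorm _).trans
        (mul_le_mul_of_nonneg_left (hstep _ _) (norm_nonneg _))
    have h3 := norm_add_le ((S.loopCLM ^ t) (X ω)) (∑ j ∈ Finset.range t,
      (S.loopCLM ^ j) (S.loopStep (R.w ((t - 1 - j : ℕ) : ℤ) ω)
        (R.v ((t - 1 - j : ℕ) : ℤ) ω) 0))
    have h4 : H ω < L₂ := hcon.2
    simp only [H] at h4
    linarith
  calc _ ≤ μ.real ({ω | L₁ < ‖X ω‖} ∪ {ω | L₂ ≤ H ω}) := measureReal_mono hsub
    _ ≤ _ := measureReal_union_le _ _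
    _ ≤ δ := by linarith

/-! ### Effect of the attack on the plant state -/

/-- The attack that replays the plant's unforced motion shifts the initial plant state seen by the
controller. -/
theorem attackedPair_eq {s : ℕ → EuclideanSpace ℝ (Fin n)}
    (hs : ∀ t, s (t + 1) = S.A.toEuclideanLin (s t)) (t : ℕ) (ω : Ω) :
    R.attackedPair (fun t _ => -S.C.toEuclideanLin (s t)) t ω =
      S.trajectory (fun k => R.w k ω) (fun k => R.v k ω) (R.x 0 ω - s 0, R.χ (-1) ω) t +
        (s t, 0) := by
  induction t with
  | zero => simp [attackedPair, trajectory]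
  | succ t ih =>
    have hout : S.output (S.trajectory (fun k => R.w k ω) (fun k => R.v k ω)
          (R.x 0 ω - s 0, R.χ (-1) ω) t + (s t, 0)).1 (R.v t ω) + -S.C.toEuclideanLin (s t) =
        S.output (S.trajectory (fun k => R.w k ω) (fun k => R.v k ω)
          (R.x 0 ω - s 0, R.χ (-1) ω) t).1 (R.v t ω) := by
      simp only [output, Prod.fst_add, map_add]; abel
    simp only [attackedPair, trajectory, loopStep]
    rw [ih, hout, hs]
    ext1
    · simp only [plantStep, Prod.fst_add, Prod.snd_add, map_add, add_zero]; abel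
    · simp

theorem exists_measureReal_attackedState_ge [IsProbabilityMeasure μ]
    (hcl : IsAsymptoticallyStable S.closedLoop) {s : ℕ → EuclideanSpace ℝ (Fin n)}
    (hs : ∀ t, s (t + 1) = S.A.toEuclideanLin (s t)) (hunb : ∀ K : ℝ, ∃ t, K < ‖s t‖)
    (α : ℝ) {δ : ℝ} (hδ : 0 < δ) :
    ∃ t : ℕ, 1 - δ ≤ μ.real {ω | α ≤
      ‖R.attackedState (fun t _ => -S.C.toEuclideanLin (s t)) t ω‖} := by
  have hX : Measurable fun ω => (R.x 0 ω - s 0, R.χ (-1) ω) :=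
    ((R.measurable_x 0).sub_const _).prodMk (R.measurable_χ (-1))
  obtain ⟨L, hL⟩ := R.exists_measureReal_trajectory_gt_le hcl hX hδ
  -- If the fictitious state has norm at most `L`, the triangle inequality leaves the attacked state
  -- norm above `α`.
  obtain ⟨t, ht⟩ := hunb (α + L)
  refine ⟨t, ?_⟩
  have hcover : (Set.univ : Set Ω) ⊆ {ω | α ≤
      ‖R.attackedState (fun t _ => -S.C.toEuclideanLin (s t)) t ω‖} ∪
      {ω | L < ‖S.trajectory (fun k => R.w k ω) (fun k => R.v k ω)
        (R.x 0 ω - s 0, R.χ (-1) ω) t‖} := by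
    intro ω _
    by_contra hcon
    simp only [Set.mem_union, Set.mem_ofPred_eq, not_or, not_lt, not_le, attackedState,
      R.attackedPair_eq hs, Prod.fst_add] at hcon
    have h1 := norm_sub_le ((S.trajectory (fun k => R.w k ω) (fun k => R.v k ω)
        (R.x 0 ω - s 0, R.χ (-1) ω) t).1 + s t) ((S.trajectory (fun k => R.w k ω)
        (fun k => R.v k ω) (R.x 0 ω - s 0, R.χ (-1) ω) t).1)
    rw [add_sub_cancel_left] at h1
    have h2 := norm_fst_le (S.trajectory (fun k => R.w k ω)
        (fun k => R.v k ω) (R.x 0 ω - s 0, R.χ (-1) ω) t)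
    linarith [hcon.1, hcon.2]
  have h := (measureReal_mono (μ := μ) hcover).trans (measureReal_union_le _ _)
  rw [probReal_univ] at h
  linarith [hL t]

end Run

end LTIControlSystem

namespace LTIControlSystem

variable {n m p q : ℕ} (S : LTIControlSystem n m p q)

/-! ### The detector's record as a function of the noise just before the attack -/

theorem measurable_plantStep {Ω : Type*} [MeasurableSpace Ω]
    {x w : Ω → EuclideanSpace ℝ (Fin n)} {u : Ω → EuclideanSpace ℝ (Fin m)}
    (hx : Measurable x) (hu : Measurable u) (hw : Measurable w) :
    Measurable fun ω => S.plantStep (x ω) (u ω) (w ω) :=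
  (((LinearMap.continuous_of_finiteDimensional S.A.toEuclideanLin).measurable.comp hx).add
    ((LinearMap.continuous_of_finiteDimensional S.B.toEuclideanLin).measurable.comp hu)).add hw

theorem measurable_output {Ω : Type*} [MeasurableSpace Ω]
    {x : Ω → EuclideanSpace ℝ (Fin n)} {v : Ω → EuclideanSpace ℝ (Fin p)}
    (hx : Measurable x) (hv : Measurable v) : Measurable fun ω => S.output (x ω) (v ω) :=
  ((LinearMap.continuous_of_finiteDimensional S.C.toEuclideanLin).measurable.comp hx).add hv

theorem measurable_controllerStep {Ω : Type*} [MeasurableSpace Ω]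
    {χ : Ω → EuclideanSpace ℝ (Fin q)} {y : Ω → EuclideanSpace ℝ (Fin p)}
    (hχ : Measurable χ) (hy : Measurable y) : Measurable fun ω => S.controllerStep (χ ω) (y ω) :=
  ((LinearMap.continuous_of_finiteDimensional S.Ac.toEuclideanLin).measurable.comp hχ).add
    ((LinearMap.continuous_of_finiteDimensional S.Bc.toEuclideanLin).measurable.comp hy)

theorem measurable_control {Ω : Type*} [MeasurableSpace Ω]
    {χ : Ω → EuclideanSpace ℝ (Fin q)} (hχ : Measurable χ) :
    Measurable fun ω => S.control (χ ω) :=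
  (LinearMap.continuous_of_finiteDimensional S.Cc.toEuclideanLin).measurable.comp hχ

theorem measurable_trajectory {Ω : Type*} [MeasurableSpace Ω]
    {w : ℕ → Ω → EuclideanSpace ℝ (Fin n)} {v : ℕ → Ω → EuclideanSpace ℝ (Fin p)}
    {X : Ω → EuclideanSpace ℝ (Fin n) × EuclideanSpace ℝ (Fin q)}
    (hw : ∀ k, Measurable (w k)) (hv : ∀ k, Measurable (v k)) (hX : Measurable X) (t : ℕ) :
    Measurable fun ω => S.trajectory (fun k => w k ω) (fun k => v k ω) (X ω) t := by
  induction t with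
  | zero => exact hX
  | succ t ih =>
    have hχ := S.measurable_controllerStep ih.snd (S.measurable_output ih.fst (hv t))
    exact (S.measurable_plantStep ih.fst (S.measurable_control hχ) (hw t)).prodMk hχ

/-- The data at time `t`, where `obs` is the record before time `0`, the states at time `-1` are
`x` and `χ`, the process noise at time `-1` is `u`, and the later noises are `w` and `v`. -/
def record (obs : ℤ → EuclideanSpace ℝ (Fin p) × EuclideanSpace ℝ (Fin q))
    (x : EuclideanSpace ℝ (Fin n)) (χ : EuclideanSpace ℝ (Fin q))
    (w : ℕ → EuclideanSpace ℝ (Fin n)) (v : ℕ → EuclideanSpace ℝ (Fin p))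
    (u : EuclideanSpace ℝ (Fin n)) (t : ℤ) :
    EuclideanSpace ℝ (Fin p) × EuclideanSpace ℝ (Fin q) :=
  if t < 0 then obs t
  else (S.output (S.trajectory w v (S.plantStep x (S.control χ) u, χ) t.toNat).1 (v t.toNat),
    (S.trajectory w v (S.plantStep x (S.control χ) u, χ) (t.toNat + 1)).2)

theorem measurable_record {Ω : Type*} [MeasurableSpace Ω]
    {obs : ℤ → Ω → EuclideanSpace ℝ (Fin p) × EuclideanSpace ℝ (Fin q)}
    {x : Ω → EuclideanSpace ℝ (Fin n)} {χ : Ω → EuclideanSpace ℝ (Fin q)}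
    {w : ℕ → Ω → EuclideanSpace ℝ (Fin n)} {v : ℕ → Ω → EuclideanSpace ℝ (Fin p)}
    (hobs : ∀ t < 0, Measurable (obs t)) (hx : Measurable x) (hχ : Measurable χ)
    (hw : ∀ k, Measurable (w k)) (hv : ∀ k, Measurable (v k)) (t : ℤ) :
    Measurable fun z : EuclideanSpace ℝ (Fin n) × Ω =>
      S.record (fun k => obs k z.2) (x z.2) (χ z.2) (fun k => w k z.2) (fun k => v k z.2) z.1 t := by
  unfold record
  split_ifs with ht
  · exact (hobs t ht).comp measurable_snd
  · have hX := (S.measurable_plantStep (hx.comp measurable_snd)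
      (S.measurable_control (hχ.comp measurable_snd))
      (measurable_fst (α := EuclideanSpace ℝ (Fin n)) (β := Ω))).prodMk (hχ.comp measurable_snd)
    have htraj := S.measurable_trajectory (fun k => (hw k).comp measurable_snd)
      (fun k => (hv k).comp measurable_snd) hX
    exact (S.measurable_output (htraj t.toNat).fst ((hv t.toNat).comp measurable_snd)).prodMk
      (htraj (t.toNat + 1)).snd

/-! ### Passing to a run that satisfies its equations everywhere -/

namespace Run

variable {S}
variable {Ω : Type*} [mΩ : MeasurableSpace Ω] {μ : Measure Ω} (R : S.Run μ)

/-- All processes are set to zero on a null set; the equations are homogeneous, so zero solves them.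
Pointwise equations are needed because measurability with respect to the sub-σ-algebras below is not
stable under changes on null sets. -/
theorem exists_ae_eq_forall_eq :
    ∃ R' : S.Run μ,
      (∀ t ω, R'.x (t + 1) ω = S.plantStep (R'.x t ω) (S.control (R'.χ t ω)) (R'.w t ω)) ∧
      (∀ t ω, R'.χ t ω = S.controllerStep (R'.χ (t - 1) ω) (S.output (R'.x t ω) (R'.v t ω))) ∧
      ∀ᵐ ω ∂μ, ∀ t, R'.w t ω = R.w t ω ∧ R'.v t ω = R.v t ω ∧ R'.x t ω = R.x t ω ∧
        R'.χ t ω = R.χ t ω := by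
  have hae : ∀ᵐ ω ∂μ, ∀ t,
      R.x (t + 1) ω = S.plantStep (R.x t ω) (S.control (R.χ t ω)) (R.w t ω) ∧
      R.χ t ω = S.controllerStep (R.χ (t - 1) ω) (S.output (R.x t ω) (R.v t ω)) :=
    ae_all_iff.2 fun t => (R.plant_eq t).and (R.controller_eq t)
  obtain ⟨T, hT, hTm, hT0⟩ := exists_measurable_superset_of_null (ae_iff.1 hae)
  have hE : ∀ ω ∈ Tᶜ, ∀ t,
      R.x (t + 1) ω = S.plantStep (R.x t ω) (S.control (R.χ t ω)) (R.w t ω) ∧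
      R.χ t ω = S.controllerStep (R.χ (t - 1) ω) (S.output (R.x t ω) (R.v t ω)) := by
    intro ω hω
    by_contra hcon
    exact hω (hT hcon)
  have hEae : ∀ᵐ ω ∂μ, ω ∈ Tᶜ := measure_eq_zero_iff_ae_notMem.1 hT0
  have hplant : ∀ t ω, (Tᶜ.indicator (R.x (t + 1)) ω) = S.plantStep (Tᶜ.indicator (R.x t) ω)
      (S.control (Tᶜ.indicator (R.χ t) ω)) (Tᶜ.indicator (R.w t) ω) := by
    intro t ω
    by_cases hω : ω ∈ Tᶜ
    · simpa only [Set.indicator_of_mem hω] using (hE ω hω t).1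
    · simp [Set.indicator_of_notMem hω, plantStep, control]
  have hctrl : ∀ t ω, (Tᶜ.indicator (R.χ t) ω) = S.controllerStep (Tᶜ.indicator (R.χ (t - 1)) ω)
      (S.output (Tᶜ.indicator (R.x t) ω) (Tᶜ.indicator (R.v t) ω)) := by
    intro t ω
    by_cases hω : ω ∈ Tᶜ
    · simpa only [Set.indicator_of_mem hω] using (hE ω hω t).2
    · simp [Set.indicator_of_notMem hω, controllerStep, output]
  refine ⟨{
    w := fun t => Tᶜ.indicator (R.w t)
    v := fun t => Tᶜ.indicator (R.v t)
    x := fun t => Tᶜ.indicator (R.x t)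
    χ := fun t => Tᶜ.indicator (R.χ t)
    measurable_w := fun t => (R.measurable_w t).indicator hTm.compl
    measurable_v := fun t => (R.measurable_v t).indicator hTm.compl
    measurable_x := fun t => (R.measurable_x t).indicator hTm.compl
    measurable_χ := fun t => (R.measurable_χ t).indicator hTm.compl
    hasLaw_w := fun t => (R.hasLaw_w t).congr (by
      filter_upwards [hEae] with ω hω; rw [Set.indicator_of_mem hω])
    hasLaw_v := fun t => (R.hasLaw_v t).congr (by
      filter_upwards [hEae] with ω hω; rw [Set.indicator_of_mem hω])
    indep_w_v := fun t => (R.indep_w_v t).congr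
      (by filter_upwards [hEae] with ω hω; rw [Set.indicator_of_mem hω])
      (by filter_upwards [hEae] with ω hω; rw [Set.indicator_of_mem hω])
    indep_time := R.indep_time.congr fun t => by
      filter_upwards [hEae] with ω hω
      rw [Set.indicator_of_mem hω, Set.indicator_of_mem hω]
    nonanticipative := fun t => (R.nonanticipative t).congr
      (by filter_upwards [hEae] with ω hω; simp only [Set.indicator_of_mem hω])
      (by filter_upwards [hEae] with ω hω; simp only [Set.indicator_of_mem hω])
    plant_eq := fun t => Eventually.of_forall (hplant t)
    controller_eq := fun t => Eventually.of_forall (hctrl t) }, hplant, hctrl, ?_⟩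
  filter_upwards [hEae] with ω hω t
  simp only [Set.indicator_of_mem hω, and_self]

theorem attackedPair_congr {R R' : S.Run μ} {ω : Ω} (a : ℕ → Ω → EuclideanSpace ℝ (Fin p))
    (h : ∀ t, R'.w t ω = R.w t ω ∧ R'.v t ω = R.v t ω ∧ R'.x t ω = R.x t ω ∧
      R'.χ t ω = R.χ t ω) (t : ℕ) : R'.attackedPair a t ω = R.attackedPair a t ω := by
  induction t with
  | zero => simp [attackedPair, h]
  | succ t ih => simp [attackedPair, h, ih]

theorem IsStealthy.congr {R R' : S.Run μ} {ε : ℝ} {a : ℕ → Ω → EuclideanSpace ℝ (Fin p)}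
    (hR : R'.IsStealthy ε a)
    (h : ∀ᵐ ω ∂μ, ∀ t, R'.w t ω = R.w t ω ∧ R'.v t ω = R.v t ω ∧ R'.x t ω = R.x t ω ∧
      R'.χ t ω = R.χ t ω) : R.IsStealthy ε a := by
  rintro t ⟨D, hD, hlt⟩
  refine hR t ⟨D, hD, lt_of_eq_of_lt ?_ hlt⟩
  have hobs : ∀ᵐ ω ∂μ, ∀ s, R'.observation s ω = R.observation s ω ∧
      R'.attackedObservation a s ω = R.attackedObservation a s ω := by
    filter_upwards [h] with ω hω s
    have hpair := attackedPair_congr a hω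
    have h1 : R'.observation s ω = R.observation s ω := by
      simp only [observation, (hω s).2.1, (hω s).2.2.1, (hω s).2.2.2]
    refine ⟨h1, ?_⟩
    simp only [attackedObservation, attackedMeasurement, attackedController, attackedState, h1,
      hpair, (hω _).2.1]
  unfold errorSum
  congr 1
  · refine measureReal_congr ?_
    filter_upwards [hobs] with ω hω
    exact congrArg (fun r => D r = false) (funext fun s => (hω s).2)
  · refine measureReal_congr ?_
    filter_upwards [hobs] with ω hω
    exact congrArg (fun r => D r = true) (funext fun s => (hω s).1)

/-! ### Independence of `w_{-1}` from all other data -/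

/-- The σ-algebra of the states at time `-k-1` and of all noises from then on, except for the
process noise at time `-1`. -/
abbrev otherNoise (k : ℕ) : MeasurableSpace Ω :=
  MeasurableSpace.comap (fun ω => (R.x (-k - 1) ω, R.χ (-k - 1 - 1) ω)) inferInstance ⊔
    ((⨆ s ∈ {s : ℤ | -k - 1 ≤ s ∧ s ≠ -1},
      MeasurableSpace.comap (fun ω => (R.w s ω, R.v s ω)) inferInstance) ⊔
    MeasurableSpace.comap (R.v (-1)) inferInstance)

theorem otherNoise_le (k : ℕ) : R.otherNoise k ≤ mΩ :=
  sup_le ((R.measurable_x _).prodMk (R.measurable_χ _)).comap_le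
    (sup_le (iSup₂_le fun s _ => ((R.measurable_w s).prodMk (R.measurable_v s)).comap_le)
      (R.measurable_v (-1)).comap_le)

theorem measurable_state_otherNoise (k : ℕ) :
    Measurable[R.otherNoise k] fun ω => (R.x (-k - 1) ω, R.χ (-k - 1 - 1) ω) :=
  (comap_measurable _).mono le_sup_left le_rfl

theorem measurable_noise_otherNoise (k : ℕ) {s : ℤ} (h : -k - 1 ≤ s) (hs : s ≠ -1) :
    Measurable[R.otherNoise k] fun ω => (R.w s ω, R.v s ω) :=
  (comap_measurable _).mono
    ((le_iSup₂_of_le (f := fun (s : ℤ) (_ : s ∈ {s : ℤ | -k - 1 ≤ s ∧ s ≠ -1}) =>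
      MeasurableSpace.comap (fun ω => (R.w s ω, R.v s ω)) inferInstance) s ⟨h, hs⟩ le_rfl).trans
      (le_sup_left.trans le_sup_right)) le_rfl

theorem measurable_v_otherNoise (k : ℕ) {s : ℤ} (h : -k - 1 ≤ s) :
    Measurable[R.otherNoise k] (R.v s) := by
  by_cases hs : s = -1
  · subst hs
    exact (comap_measurable _).mono (le_sup_right.trans le_sup_right) le_rfl
  · exact measurable_snd.comp (R.measurable_noise_otherNoise k h hs)

/-- `indep_sup_of_indep_sup` is used twice: independence across times and of `w_{-1}` from `v_{-1}`
handles the noises, then nonanticipativity at time `-k-1` adjoins the states. -/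
theorem indep_otherNoise [IsProbabilityMeasure μ] (k : ℕ) :
    Indep (MeasurableSpace.comap (R.w (-1)) inferInstance) (R.otherNoise k) μ := by
  have hw : MeasurableSpace.comap (R.w (-1)) inferInstance ≤
      MeasurableSpace.comap (fun ω => (R.w (-1) ω, R.v (-1) ω)) inferInstance :=
    measurable_iff_comap_le.1
      (measurable_fst.comp (comap_measurable fun ω => (R.w (-1) ω, R.v (-1) ω)))
  have hv : MeasurableSpace.comap (R.v (-1)) inferInstance ≤
      MeasurableSpace.comap (fun ω => (R.w (-1) ω, R.v (-1) ω)) inferInstance :=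
    measurable_iff_comap_le.1
      (measurable_snd.comp (comap_measurable fun ω => (R.w (-1) ω, R.v (-1) ω)))
  have hN : ∀ s, MeasurableSpace.comap (fun ω => (R.w s ω, R.v s ω)) inferInstance ≤ mΩ :=
    fun s => ((R.measurable_w s).prodMk (R.measurable_v s)).comap_le
  have hNfut : ∀ s : ℤ, -k - 1 ≤ s →
      MeasurableSpace.comap (fun ω => (R.w s ω, R.v s ω)) inferInstance ≤
      MeasurableSpace.comap (fun ω (s : Set.Ici (-k - 1 : ℤ)) => (R.w s ω, R.v s ω))
        inferInstance := fun s hs =>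
    measurable_iff_comap_le.1 ((measurable_pi_apply (⟨s, hs⟩ : Set.Ici (-k - 1 : ℤ))).comp
      (comap_measurable fun ω (s : Set.Ici (-k - 1 : ℤ)) => (R.w s ω, R.v s ω)))
  have h1 : Indep (⨆ s ∈ {s : ℤ | -k - 1 ≤ s ∧ s ≠ -1},
      MeasurableSpace.comap (fun ω => (R.w s ω, R.v s ω)) inferInstance)
      (⨆ s ∈ ({-1} : Set ℤ),
        MeasurableSpace.comap (fun ω => (R.w s ω, R.v s ω)) inferInstance) μ :=
    indep_iSup_of_disjoint hN R.indep_time.iIndep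
      (Set.disjoint_singleton_right.2 fun h => h.2 rfl)
  rw [iSup_singleton] at h1
  have h2 := indep_sup_of_indep_sup (hw.trans (hN _)) (hv.trans (hN _))
    (iSup₂_le fun s _ => hN s) (indep_of_indep_of_le_right h1 (sup_le hw hv))
    (R.indep_w_v (-1))
  refine indep_sup_of_indep_sup (hw.trans (hN _))
    (sup_le (iSup₂_le fun s _ => hN s) (hv.trans (hN _)))
    ((R.measurable_x _).prodMk (R.measurable_χ _)).comap_le ?_ h2
  refine indep_of_indep_of_le (R.nonanticipative (-k - 1)) ?_ ?_
  · exact measurable_iff_comap_le.1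
      ((measurable_pi_apply (⟨-k - 1, Set.self_mem_Iic⟩ : Set.Iic (-k - 1 : ℤ))).comp
        (comap_measurable fun ω (s : Set.Iic (-k - 1 : ℤ)) => (R.x s ω, R.χ (s - 1) ω)))
  · exact sup_le (hw.trans (hNfut _ (by omega))) (sup_le (iSup₂_le fun s hs => hNfut s hs.1)
      (hv.trans (hNfut _ (by omega))))

theorem measurable_χ_otherNoise
    (hctrl : ∀ t ω, R.χ t ω = S.controllerStep (R.χ (t - 1) ω) (S.output (R.x t ω) (R.v t ω)))
    (k : ℕ) : Measurable[R.otherNoise k] (R.χ (-k - 1)) := by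
  have hs := R.measurable_state_otherNoise k
  rw [funext (hctrl (-k - 1))]
  exact @measurable_controllerStep _ _ _ _ S _ (R.otherNoise k) _ _ (measurable_snd.comp hs)
    (@measurable_output _ _ _ _ S _ (R.otherNoise k) _ _ (measurable_fst.comp hs)
      (R.measurable_v_otherNoise k le_rfl))

/-- The states at `-k-1` arise from those at `-k-2` by one step driven by `w_{-k-2}`, never by
`w_{-1}`. Monotonicity lets independence pass to the supremum, which covers the infinite past of the
record. -/
theorem otherNoise_mono
    (hplant : ∀ t ω, R.x (t + 1) ω = S.plantStep (R.x t ω) (S.control (R.χ t ω)) (R.w t ω))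
    (hctrl : ∀ t ω, R.χ t ω = S.controllerStep (R.χ (t - 1) ω) (S.output (R.x t ω) (R.v t ω))) :
    Monotone R.otherNoise := by
  refine monotone_nat_of_le_succ fun k => sup_le ?_ (sup_le (iSup₂_le fun s hs => ?_) ?_)
  · have hs := R.measurable_state_otherNoise (k + 1)
    have hχ := R.measurable_χ_otherNoise hctrl (k + 1)
    have hw := measurable_fst.comp
      (R.measurable_noise_otherNoise (k + 1) (s := -(k + 1 : ℕ) - 1) le_rfl (by omega))
    have hx := @measurable_plantStep _ _ _ _ S _ (R.otherNoise (k + 1)) _ _ _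
      (measurable_fst.comp hs) (@measurable_control _ _ _ _ S _ (R.otherNoise (k + 1)) _ hχ) hw
    have heq : (fun ω => (R.x (-k - 1) ω, R.χ (-k - 1 - 1) ω)) = fun ω =>
        (S.plantStep (R.x (-(k + 1 : ℕ) - 1) ω) (S.control (R.χ (-(k + 1 : ℕ) - 1) ω))
          (R.w (-(k + 1 : ℕ) - 1) ω), R.χ (-(k + 1 : ℕ) - 1) ω) := by
      funext ω
      rw [← hplant, show (-(k + 1 : ℕ) - 1 + 1 : ℤ) = -k - 1 by push_cast; ring,
        show (-(k + 1 : ℕ) - 1 : ℤ) = -k - 1 - 1 by push_cast; ring]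
    rw [heq]
    exact measurable_iff_comap_le.1 (hx.prodMk hχ)
  · exact measurable_iff_comap_le.1
      (R.measurable_noise_otherNoise (k + 1) (by have := hs.1; push_cast; omega) hs.2)
  · exact measurable_iff_comap_le.1 (R.measurable_v_otherNoise (k + 1) (by omega))

theorem trajectory_eq_state
    (hplant : ∀ t ω, R.x (t + 1) ω = S.plantStep (R.x t ω) (S.control (R.χ t ω)) (R.w t ω))
    (hctrl : ∀ t ω, R.χ t ω = S.controllerStep (R.χ (t - 1) ω) (S.output (R.x t ω) (R.v t ω)))
    (t : ℕ) (ω : Ω) :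
    S.trajectory (fun k => R.w k ω) (fun k => R.v k ω) (R.x 0 ω, R.χ (-1) ω) t =
      (R.x t ω, R.χ (t - 1) ω) := by
  induction t with
  | zero => simp [trajectory]
  | succ t ih =>
    simp only [trajectory, loopStep, ih]
    rw [← hctrl, ← hplant]
    push_cast
    rw [add_sub_cancel_right]

/-- The record of the detector as a function of the process noise at time `-1`. -/
def recordOf (s : ℤ) (z : EuclideanSpace ℝ (Fin n) × Ω) :
    EuclideanSpace ℝ (Fin p) × EuclideanSpace ℝ (Fin q) :=
  S.record (fun k => R.observation k z.2) (R.x (-1) z.2) (R.χ (-1) z.2) (fun k => R.w k z.2)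
    (fun k => R.v k z.2) z.1 s

theorem recordOf_eq_observation
    (hplant : ∀ t ω, R.x (t + 1) ω = S.plantStep (R.x t ω) (S.control (R.χ t ω)) (R.w t ω))
    (hctrl : ∀ t ω, R.χ t ω = S.controllerStep (R.χ (t - 1) ω) (S.output (R.x t ω) (R.v t ω)))
    (s : ℤ) (ω : Ω) : R.recordOf s (R.w (-1) ω, ω) = R.observation s ω := by
  unfold recordOf record
  split_ifs with hs
  · rfl
  · lift s to ℕ using not_lt.1 hs
    have h0 := hplant (-1) ω
    rw [neg_add_cancel] at h0
    rw [← h0, R.trajectory_eq_state hplant hctrl, R.trajectory_eq_state hplant hctrl]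
    simp [observation]

/-- Subtracting `σ 0` from `w_{-1}` shifts `x_0` by `-σ 0` and leaves `χ_{-1}` and the earlier
record unchanged; afterwards the attack cancels `C σ_t` in the received output. -/
theorem recordOf_eq_attackedObservation
    (hplant : ∀ t ω, R.x (t + 1) ω = S.plantStep (R.x t ω) (S.control (R.χ t ω)) (R.w t ω))
    {σ : ℕ → EuclideanSpace ℝ (Fin n)} (hσ : ∀ t, σ (t + 1) = S.A.toEuclideanLin (σ t))
    (s : ℤ) (ω : Ω) : R.recordOf s (R.w (-1) ω - σ 0, ω) =
      R.attackedObservation (fun t _ => -S.C.toEuclideanLin (σ t)) s ω := by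
  unfold recordOf record attackedObservation
  split_ifs with hs
  · rfl
  · have h0 := hplant (-1) ω
    rw [neg_add_cancel] at h0
    have h1 : S.plantStep (R.x (-1) ω) (S.control (R.χ (-1) ω)) (R.w (-1) ω - σ 0) =
        R.x 0 ω - σ 0 := by
      rw [h0]; simp only [plantStep]; abel
    simp only [h1, attackedMeasurement, attackedState, attackedController,
      R.attackedPair_eq hσ, Prod.fst_add, Prod.snd_add, add_zero, output, map_add]
    congr 1
    abel

/-! ### The stealth estimate -/

/-- The σ-algebra of all data but the process noise at time `-1`. -/
abbrev allOtherNoise : MeasurableSpace Ω := ⨆ k, R.otherNoise k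

theorem isStealthy_of_forall_eq [IsProbabilityMeasure μ]
    (hplant : ∀ t ω, R.x (t + 1) ω = S.plantStep (R.x t ω) (S.control (R.χ t ω)) (R.w t ω))
    (hctrl : ∀ t ω, R.χ t ω = S.controllerStep (R.χ (t - 1) ω) (S.output (R.x t ω) (R.v t ω)))
    {σ : ℕ → EuclideanSpace ℝ (Fin n)} (hσ : ∀ t, σ (t + 1) = S.A.toEuclideanLin (σ t))
    {ε : ℝ} (hε : 0 < ε)
    (hshift : ∀ B : Set (EuclideanSpace ℝ (Fin n)), MeasurableSet B →
      multivariateGaussian 0 S.covW ((fun w => w - σ 0) ⁻¹' B) ≤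
        multivariateGaussian 0 S.covW B + ENNReal.ofReal ε) :
    R.IsStealthy ε (fun t _ => -S.C.toEuclideanLin (σ t)) := by
  rintro t ⟨D, hD, hlt⟩
  have hH : R.allOtherNoise ≤ mΩ := iSup_le R.otherNoise_le
  have hkH : ∀ k, R.otherNoise k ≤ R.allOtherNoise := fun k => le_iSup R.otherNoise k
  have hind : Indep (MeasurableSpace.comap (R.w (-1)) inferInstance) R.allOtherNoise μ :=
    (indep_iSup_of_monotone (fun k => (R.indep_otherNoise k).symm) R.otherNoise_le
      (R.measurable_w (-1)).comap_le (R.otherNoise_mono hplant hctrl)).symm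
  -- The second variable is the whole outcome `ω`, seen through the σ-algebra that omits `w_{-1}`.
  have hindf : @IndepFun Ω _ Ω mΩ _ R.allOtherNoise (R.w (-1)) id μ := by
    refine (@IndepFun_iff_Indep Ω _ Ω mΩ _ R.allOtherNoise (R.w (-1)) id μ).2 ?_
    rw [MeasurableSpace.comap_id]
    exact hind
  have hstate : ∀ k : ℕ, Measurable[R.allOtherNoise] (R.x (-k - 1)) := fun k =>
    (measurable_fst.comp (R.measurable_state_otherNoise k)).mono (hkH k) le_rfl
  have hctrlm : ∀ k : ℕ, Measurable[R.allOtherNoise] (R.χ (-k - 1)) := fun k =>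
    (R.measurable_χ_otherNoise hctrl k).mono (hkH k) le_rfl
  have hobs : ∀ s < 0, Measurable[R.allOtherNoise] (R.observation s) := by
    intro s hs
    obtain ⟨k, rfl⟩ : ∃ k : ℕ, s = -k - 1 := ⟨(-s - 1).toNat, by omega⟩
    exact @Measurable.prodMk _ R.allOtherNoise _ _ _ _ _ _
      (@measurable_output _ _ _ _ S _ R.allOtherNoise _ _ (hstate k)
        ((R.measurable_v_otherNoise k le_rfl).mono (hkH k) le_rfl)) (hctrlm k)
  have hnoise : ∀ k : ℕ, Measurable[R.allOtherNoise] fun ω => (R.w k ω, R.v k ω) := fun k =>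
    (R.measurable_noise_otherNoise 0 (s := k) (by omega) (by omega)).mono (hkH 0) le_rfl
  have hrec : ∀ s, @Measurable _ _ (@Prod.instMeasurableSpace _ _ _ R.allOtherNoise) _ (R.recordOf s) := fun s =>
    @measurable_record _ _ _ _ S Ω R.allOtherNoise _ _ _ _ _ hobs (by simpa using hstate 0)
      (by simpa using hctrlm 0) (fun k => measurable_fst.comp (hnoise k))
      (fun k => measurable_snd.comp (hnoise k)) s
  let Φ : EuclideanSpace ℝ (Fin n) × Ω → Bool := fun z => D fun s => R.recordOf s z
  have hΦ : @Measurable _ _ (@Prod.instMeasurableSpace _ _ _ R.allOtherNoise) _ Φ :=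
    hD.comp (@measurable_pi_lambda _ _ _ (@Prod.instMeasurableSpace _ _ _ R.allOtherNoise) _ _ fun s => hrec s)
  have hle := measure_sub_mem_le (mF := R.allOtherNoise) (μ := μ) (R.measurable_w (-1))
    (measurable_id'' hH) hindf (s := σ 0) (c := ENNReal.ofReal ε)
    (by rw [(R.hasLaw_w (-1)).map_eq]; exact hshift)
    (hΦ (measurableSet_singleton true))
  have hΦobs : ∀ ω, Φ (R.w (-1) ω, ω) = D fun s => R.observation s ω := fun ω =>
    congrArg D (funext fun s => R.recordOf_eq_observation hplant hctrl s ω)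
  have hΦatt : ∀ ω, Φ (R.w (-1) ω - σ 0, ω) =
      D fun s => R.attackedObservation (fun t _ => -S.C.toEuclideanLin (σ t)) s ω := fun ω =>
    congrArg D (funext fun s => R.recordOf_eq_attackedObservation hplant hσ s ω)
  -- Measurability for the full σ-algebra is needed too, because `w_{-1}` itself is substituted into
  -- `Φ`.
  have hΦ' : @Measurable _ _ Prod.instMeasurableSpace _ Φ :=
    hΦ.mono (sup_le_sup le_rfl (MeasurableSpace.comap_mono hH)) le_rfl
  have hmeas : MeasurableSet {ω | Φ (R.w (-1) ω - σ 0, ω) = true} :=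
    (hΦ'.comp (((R.measurable_w (-1)).sub_const _).prodMk measurable_id))
      (measurableSet_singleton true)
  have hreal : μ.real {ω | Φ (R.w (-1) ω - σ 0, ω) = true} ≤
      μ.real {ω | Φ (R.w (-1) ω, ω) = true} + ε := by
    have h := ENNReal.toReal_mono (by finiteness) hle
    rw [ENNReal.toReal_add (by finiteness) (by finiteness), ENNReal.toReal_ofReal hε.le] at h
    exact h
  have hfalse : {ω | Φ (R.w (-1) ω - σ 0, ω) = false} =
      {ω | Φ (R.w (-1) ω - σ 0, ω) = true}ᶜ := by
    ext ω; simp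
  unfold errorSum at hlt
  simp only [← hΦobs, ← hΦatt] at hlt
  rw [hfalse, probReal_compl_eq_one_sub hmeas] at hlt
  linarith

end Run
end LTIControlSystem

end

theorem corollary1 {n m p q : ℕ} (S : LTIControlSystem n m p q)
    (hW : S.covW.PosDef) (hV : S.covV.PosSemidef)
    {Ω : Type*} [MeasurableSpace Ω] (μ : Measure Ω) [IsProbabilityMeasure μ] (R : S.Run μ)
    (hA : IsUnstableMatrix S.A) (hcl : IsAsymptoticallyStable S.closedLoop) :
    ∀ ε > 0, ∀ α : ℝ,
      R.IsAttackable ε α ∧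
      ∃ s : ℕ → EuclideanSpace ℝ (Fin n),
        s 0 ≠ 0 ∧ (∀ t, s (t + 1) = S.A.toEuclideanLin (s t)) ∧
        R.IsSuccessful ε α (fun t _ => -S.C.toEuclideanLin (s t)) := by
  intro ε hε α
  suffices h : ∃ s : ℕ → EuclideanSpace ℝ (Fin n),
      s 0 ≠ 0 ∧ (∀ t, s (t + 1) = S.A.toEuclideanLin (s t)) ∧
      R.IsSuccessful ε α (fun t _ => -S.C.toEuclideanLin (s t)) by
    obtain ⟨s, hs0, hs, hsucc⟩ := h
    exact ⟨⟨_, fun t => measurable_const, hsucc⟩, s, hs0, hs, hsucc⟩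
  obtain ⟨x, hx⟩ := exists_unbounded_orbit_of_isUnstableMatrix hA
  have hx0 : x ≠ 0 := by
    rintro rfl
    obtain ⟨t, ht⟩ := hx 0
    simp at ht
  obtain ⟨r, hr, hshift⟩ := exists_measure_preimage_sub_le _
    (multivariateGaussian_absolutelyContinuous hW) hε
  have hxn : 0 < ‖x‖ := norm_pos_iff.2 hx0
  -- This gives `‖s 0‖ = r / 2`, inside the stealth radius; scaling keeps the orbit unbounded.
  let c : ℝ := r / (2 * ‖x‖)
  have hc : 0 < c := by positivity
  let s : ℕ → EuclideanSpace ℝ (Fin n) := fun t => c • ((Matrix.toEuclideanLin S.A) ^ t) x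
  have hs0 : s 0 = c • x := by simp [s]
  have hs : ∀ t, s (t + 1) = S.A.toEuclideanLin (s t) := fun t => by
    simp only [s]
    rw [pow_succ', Module.End.mul_apply, map_smul]
  have hunb : ∀ K : ℝ, ∃ t, K < ‖s t‖ := fun K => by
    obtain ⟨t, ht⟩ := hx (K / c)
    refine ⟨t, ?_⟩
    rw [norm_smul, Real.norm_of_nonneg hc.le]
    rwa [div_lt_iff₀' hc] at ht
  have hsmall : ‖s 0‖ < r := by
    rw [hs0, norm_smul, Real.norm_of_nonneg hc.le]
    have : c * ‖x‖ = r / 2 := by simp only [c]; field_simp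
    linarith
  refine ⟨s, by rw [hs0]; exact smul_ne_zero hc.ne' hx0, hs, fun δ hδ =>
    R.exists_measureReal_attackedState_ge hcl hs hunb α hδ, ?_⟩
  obtain ⟨R', hplant, hctrl, hae⟩ := R.exists_ae_eq_forall_eq
  exact (R'.isStealthy_of_forall_eq hplant hctrl hs hε (hshift _ hsmall)).congr hae
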